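/- For $\tau\in\mathbb{C}$ with $\operatorname{Im}\tau>0$ put $q=e^{2\pi i\tau}$, and let $\eta(\tau)=e^{2\pi i\tau/24}\prod_{n\ge 1}(1-q^n)$ be the Dedekind eta function. Define $$f(\tau)=\eta(\tau)^2\eta(2\tau)\eta(4\tau)\eta(8\tau)^2,\qquad g(\tau)=\eta(2\tau)^3\eta(6\tau)^3,\qquad h(\tau)=\eta(4\tau)^6 .$$ Then for every $\tau$ with $\operatorname{Im}\tau>0$ the following double series converge absolutely and $$f(\tau)=\sum_{m,n\in\mathbb{Z}}\frac{m^2-2n^2}{2}\,q^{m^2+2n^2},$$ $$g(\tau)=\sum_{m,n\in\mathbb{Z}}\frac{m^2-3n^2}{2}\,q^{m^2+3n^2},$$ $$h(\tau)=\sum_{m,n\in\mathbb{Z}}\frac{m^2-4n^2}{2}\,q^{m^2+4n^2}.$$ -/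

import Mathlib

noncomputable section

namespace EtaTheta

/-- The nome `q = e ^ (2 π i τ)`. -/
def nome (τ : ℂ) : ℂ := Complex.exp (2 * Real.pi * Complex.I * τ)

/-- `f(τ) = η(τ)² η(2τ) η(4τ) η(8τ)²`, with `η` the Dedekind eta function. -/
def f (τ : ℂ) : ℂ :=
  ModularForm.eta τ ^ 2 * ModularForm.eta (2 * τ) * ModularForm.eta (4 * τ) *
    ModularForm.eta (8 * τ) ^ 2

/-- `g(τ) = η(2τ)³ η(6τ)³`. -/
def g (τ : ℂ) : ℂ := ModularForm.eta (2 * τ) ^ 3 * ModularForm.eta (6 * τ) ^ 3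

/-- `h(τ) = η(4τ)⁶`. -/
def h (τ : ℂ) : ℂ := ModularForm.eta (4 * τ) ^ 6

end EtaTheta

end

noncomputable section

namespace EtaTheta

open Filter Topology Complex

/-! The sum of mn q^(m²+Nn²) vanishes under n ↦ -n, so a multiple of mn may be added to the
coefficient. A suitable multiple makes it a product of two linear forms that also diagonalise the
exponent: N = 2: ½(m+2n)(m-n), with 3(m²+2n²) = (m+2n)² + 2(m-n)²; N = 3: ½(m+3n)(m-n), with
4(m²+3n²) = (m+3n)² + 3(m-n)²; N = 4: ½(m+2n)(m-2n), with 2(m²+4n²) = (m+2n)² + (m-2n)². The part of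
the lattice where both forms are divisible by 3 (N = 2) or by 2 (N = 3, 4) sums to zero by a
symmetry. The rest falls into two classes exchanged by a change of sign, each giving half of a
product of two theta series with linear coefficients.

For g and h these series are Jacobi's series for η³ (`hasSum_eta_cube`). For f they are the values
at τ and 2τ of the series in `hasSum_linear_mul_qPow_third`, which is evaluated by another change of
lattice coordinates. The eta series used come from a finite triple product, by passing to the limit.
`HasSum` in ℂ is unconditional, hence absolute, convergence. -/

lemma nome_ne_zero (τ : ℂ) : nome τ ≠ 0 := Complex.exp_ne_zero _

lemma norm_nome_lt_one {τ : ℂ} (hτ : 0 < τ.im) : ‖nome τ‖ < 1 :=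
  UpperHalfPlane.norm_exp_two_pi_I_lt_one ⟨τ, hτ⟩

lemma nome_zpow (τ : ℂ) (k : ℤ) : nome τ ^ k = cexp (2 * Real.pi * I * τ * k) := by
  rw [nome, ← Complex.exp_int_mul, mul_comm]

lemma nome_pow (τ : ℂ) (k : ℕ) : nome τ ^ k = cexp (2 * Real.pi * I * τ * k) := by
  rw [nome, ← Complex.exp_nat_mul, mul_comm]

lemma one_sub_nome_pow_ne_zero {τ : ℂ} (hτ : 0 < τ.im) (n : ℕ) : 1 - nome τ ^ (n + 1) ≠ 0 := by
  rw [sub_ne_zero]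
  intro h
  have h1 := pow_lt_one₀ (norm_nonneg _) (norm_nome_lt_one hτ) n.succ_ne_zero
  rw [← norm_pow, Nat.succ_eq_add_one, ← h, norm_one] at h1
  exact lt_irrefl _ h1

/-! ### q-factorials and central q-binomial coefficients -/

/-- The finite product `(q; q)_n`. -/
def qProd (τ : ℂ) (n : ℕ) : ℂ := ∏ j ∈ Finset.range n, (1 - nome τ ^ (j + 1))

/-- The infinite product `(q; q)_∞`. -/
def qProdInf (τ : ℂ) : ℂ := ∏' j : ℕ, (1 - nome τ ^ (j + 1))

lemma qProd_succ (τ : ℂ) (n : ℕ) : qProd τ (n + 1) = qProd τ n * (1 - nome τ ^ (n + 1)) :=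
  Finset.prod_range_succ _ _

lemma qProdInf_ne_zero {τ : ℂ} (hτ : 0 < τ.im) : qProdInf τ ≠ 0 := by
  have h := ModularForm.eta_tprod_ne_zero (z := τ) hτ
  simpa only [ModularForm.eta_q_eq_pow] using! h

lemma tendsto_qProd {τ : ℂ} (hτ : 0 < τ.im) :
    Tendsto (qProd τ) atTop (𝓝 (qProdInf τ)) :=
  (ModularForm.multipliable_one_sub_pow (norm_nome_lt_one hτ)).hasProd.tendsto_prod_nat

/-- The reciprocal of `(q; q)_m`, extended by zero to negative `m`. -/
def invQProd (τ : ℂ) (m : ℤ) : ℂ := if 0 ≤ m then (qProd τ m.toNat)⁻¹ else 0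

lemma invQProd_natCast (τ : ℂ) (n : ℕ) : invQProd τ n = (qProd τ n)⁻¹ := by
  simp [invQProd]

lemma invQProd_of_neg (τ : ℂ) {m : ℤ} (hm : m < 0) : invQProd τ m = 0 := by
  simp [invQProd, not_le.mpr hm]

/-- The extension by zero is consistent: at m = -1 the factor 1 - q^0 vanishes. Recurrences for
q-binomials thus hold on all of ℤ without boundary cases. -/
lemma invQProd_eq_mul {τ : ℂ} (hτ : 0 < τ.im) (m : ℤ) :
    invQProd τ m = (1 - nome τ ^ (m + 1)) * invQProd τ (m + 1) := by
  rcases lt_trichotomy m (-1) with h | h | h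
  · rw [invQProd_of_neg τ (by omega), invQProd_of_neg τ (by omega), mul_zero]
  · subst h
    simp [invQProd_of_neg]
  · lift m to ℕ using by omega
    have h1 := one_sub_nome_pow_ne_zero hτ m
    have h2 : ((m : ℤ) + 1) = ((m + 1 : ℕ) : ℤ) := by push_cast; ring
    rw [h2, invQProd_natCast, invQProd_natCast, qProd_succ, zpow_natCast, mul_inv]
    field_simp

lemma exists_norm_invQProd_le {τ : ℂ} (hτ : 0 < τ.im) : ∃ C, ∀ m, ‖invQProd τ m‖ ≤ C := by
  have h := ((tendsto_qProd hτ).inv₀ (qProdInf_ne_zero hτ)).norm.bddAbove_range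
  obtain ⟨C, hC⟩ := h
  refine ⟨C, fun m => ?_⟩
  rcases lt_or_ge m 0 with h | h
  · rw [invQProd_of_neg τ h, norm_zero]
    exact (norm_nonneg _).trans (hC ⟨0, rfl⟩)
  · lift m to ℕ using h
    rw [invQProd_natCast]
    exact hC ⟨m, rfl⟩

lemma tendsto_invQProd {τ : ℂ} (hτ : 0 < τ.im) :
    Tendsto (invQProd τ) atTop (𝓝 (qProdInf τ)⁻¹) := by
  have ht : Tendsto Int.toNat atTop atTop := tendsto_atTop.mpr fun b => by
    filter_upwards [eventually_ge_atTop (b : ℤ)] with m hm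
    omega
  refine (((tendsto_qProd hτ).inv₀ (qProdInf_ne_zero hτ)).comp ht).congr' ?_
  filter_upwards [eventually_ge_atTop (0 : ℤ)] with m hm
  simp [invQProd, hm]

/-- The central `q`-binomial coefficient `[2n, n + k]`. -/
def qBinom (τ : ℂ) (n : ℕ) (k : ℤ) : ℂ :=
  qProd τ (2 * n) * invQProd τ (n + k) * invQProd τ (n - k)

lemma qBinom_zero (τ : ℂ) (k : ℤ) : qBinom τ 0 k = if k = 0 then 1 else 0 := by
  rcases lt_trichotomy k 0 with h | h | h
  · simp [qBinom, invQProd_of_neg τ h, h.ne]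
  · subst h
    simp [qBinom, invQProd, qProd]
  · simp [qBinom, invQProd_of_neg τ (neg_lt_zero.mpr h), h.ne']

/-- Two q-Pascal steps in one. Writing every reciprocal through those at n+k+1 and n-k+1 leaves a
polynomial identity in q^(n+k), q^(n-k) and q. -/
lemma qBinom_succ {τ : ℂ} (hτ : 0 < τ.im) (n : ℕ) (k : ℤ) :
    qBinom τ (n + 1) k = (1 + nome τ ^ (2 * n + 1)) * qBinom τ n k +
      nome τ ^ (n + 1 - k) * qBinom τ n (k - 1) + nome τ ^ (n + 1 + k) * qBinom τ n (k + 1) := by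
  have hq := nome_ne_zero τ
  have hA1 := invQProd_eq_mul hτ (n + k)
  have hA2 := invQProd_eq_mul hτ (n + (k - 1))
  have hB1 := invQProd_eq_mul hτ (n - k)
  have hB2 := invQProd_eq_mul hτ (n - (k + 1))
  rw [show (n : ℤ) + (k - 1) + 1 = n + k by ring, hA1] at hA2
  rw [show (n : ℤ) - (k + 1) + 1 = n - k by ring, hB1] at hB2
  have e1 : ((n + 1 : ℕ) : ℤ) + k = n + k + 1 := by push_cast; ring
  have e2 : ((n + 1 : ℕ) : ℤ) - k = n - k + 1 := by push_cast; ring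
  have e3 : (n : ℤ) + (k + 1) = n + k + 1 := by ring
  have e4 : (n : ℤ) - (k - 1) = n - k + 1 := by ring
  have e5 : nome τ ^ (2 * n + 1) = nome τ ^ ((n : ℤ) + k) * nome τ ^ ((n : ℤ) - k) * nome τ := by
    rw [← zpow_add₀ hq, pow_succ, ← zpow_natCast]
    congr 2
    push_cast; ring
  have e6 : (n : ℤ) + 1 - k = n - k + 1 := by ring
  have e7 : (n : ℤ) + 1 + k = n + k + 1 := by ring
  rw [qBinom, qBinom, qBinom, qBinom, hA2, hB2, e1, e2, e3, e4, hA1, hB1,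
    show 2 * (n + 1) = 2 * n + 1 + 1 by ring, qProd_succ, qProd_succ,
    pow_succ (nome τ) (2 * n + 1), e5, e6, e7]
  simp only [zpow_add_one₀ hq]
  ring

lemma exists_norm_qBinom_le {τ : ℂ} (hτ : 0 < τ.im) : ∃ C, ∀ n k, ‖qBinom τ n k‖ ≤ C := by
  obtain ⟨C, hC⟩ := exists_norm_invQProd_le hτ
  obtain ⟨D, hD⟩ := (tendsto_qProd hτ).norm.bddAbove_range
  have hD0 : 0 ≤ D := (norm_nonneg _).trans (hD ⟨0, rfl⟩)
  refine ⟨D * C * C, fun n k => ?_⟩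
  rw [qBinom, norm_mul, norm_mul]
  have hC0 : 0 ≤ C := (norm_nonneg _).trans (hC 0)
  gcongr
  · exact hD ⟨2 * n, rfl⟩
  · exact hC _
  · exact hC _

lemma tendsto_qBinom {τ : ℂ} (hτ : 0 < τ.im) (k : ℤ) :
    Tendsto (fun n => qBinom τ n k) atTop (𝓝 (qProdInf τ)⁻¹) := by
  have h1 : Tendsto (fun n : ℕ => qProd τ (2 * n)) atTop (𝓝 (qProdInf τ)) :=
    (tendsto_qProd hτ).comp (tendsto_id.const_mul_atTop' (by norm_num))
  have h2 : Tendsto (fun n : ℕ => invQProd τ (n + k)) atTop (𝓝 (qProdInf τ)⁻¹) :=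
    (tendsto_invQProd hτ).comp (tendsto_atTop_add_const_right _ k tendsto_natCast_atTop_atTop)
  have h3 : Tendsto (fun n : ℕ => invQProd τ (n - k)) atTop (𝓝 (qProdInf τ)⁻¹) :=
    (tendsto_invQProd hτ).comp (tendsto_atTop_add_const_right _ (-k) tendsto_natCast_atTop_atTop)
  have h := (h1.mul h2).mul h3
  rwa [mul_inv_cancel₀ (qProdInf_ne_zero hτ), one_mul] at h

/-! ### The Jacobi triple product and its derivative -/

/-- `q ^ (k (k - 1) / 2)`. -/
def nomeTri (τ : ℂ) (k : ℤ) : ℂ := cexp (2 * Real.pi * I * τ * (k * (k - 1) / 2))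

lemma nomeTri_add_one (τ : ℂ) (k : ℤ) : nomeTri τ (k + 1) = nomeTri τ k * nome τ ^ k := by
  rw [nomeTri, nomeTri, nome_zpow, ← Complex.exp_add]
  congr 1
  push_cast; ring

/-- The term of the finite triple product sum. -/
def tripleTerm (τ w : ℂ) (n : ℕ) (k : ℤ) : ℂ := (-w) ^ k * nomeTri τ k * qBinom τ n k

/-- This is multiplication by (1 - wq^n)(1 - w⁻¹q^(n+1)), with powers of w acting as shifts of k. -/
lemma tripleTerm_succ {τ w : ℂ} (hτ : 0 < τ.im) (hw : w ≠ 0) (n : ℕ) (k : ℤ) :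
    tripleTerm τ w (n + 1) k = (1 + nome τ ^ (2 * n + 1)) * tripleTerm τ w n k -
      w * nome τ ^ n * tripleTerm τ w n (k - 1) -
      w⁻¹ * nome τ ^ (n + 1) * tripleTerm τ w n (k + 1) := by
  have hq := nome_ne_zero τ
  have hw' : -w ≠ 0 := neg_ne_zero.mpr hw
  have h1 := nomeTri_add_one τ (k - 1)
  rw [sub_add_cancel] at h1
  have h2 : (-w) ^ k = (-w) ^ (k - 1) * (-w) := by
    rw [← zpow_add_one₀ hw', sub_add_cancel]
  have e1 : nome τ ^ (k - 1) * nome τ ^ ((n : ℤ) + 1 - k) = nome τ ^ n := by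
    rw [← zpow_add₀ hq, ← zpow_natCast]; congr 1; ring
  have e2 : nome τ ^ ((n : ℤ) + 1 + k) = nome τ ^ (n + 1) * nome τ ^ k := by
    rw [zpow_add₀ hq]; norm_cast
  have T1 : (-w) ^ k * nomeTri τ k * (nome τ ^ ((n : ℤ) + 1 - k) * qBinom τ n (k - 1)) =
      -(w * nome τ ^ n * tripleTerm τ w n (k - 1)) := by
    rw [tripleTerm, h1, h2, ← e1]; ring
  have T2 : (-w) ^ k * nomeTri τ k * (nome τ ^ ((n : ℤ) + 1 + k) * qBinom τ n (k + 1)) =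
      -(w⁻¹ * nome τ ^ (n + 1) * tripleTerm τ w n (k + 1)) := by
    rw [tripleTerm, nomeTri_add_one, zpow_add_one₀ hw', e2]
    field_simp
  have T0 : tripleTerm τ w n k = (-w) ^ k * nomeTri τ k * qBinom τ n k := rfl
  rw [tripleTerm, qBinom_succ hτ, mul_add, mul_add, T1, T2, T0]
  ring

/-- The finite form of the Jacobi triple product. -/
lemma hasSum_tripleTerm {τ w : ℂ} (hτ : 0 < τ.im) (hw : w ≠ 0) (n : ℕ) :
    HasSum (tripleTerm τ w n)
      (∏ j ∈ Finset.range n, ((1 - w * nome τ ^ j) * (1 - w⁻¹ * nome τ ^ (j + 1)))) := by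
  induction n with
  | zero =>
    convert! hasSum_single (f := tripleTerm τ w 0) 0 ?_ using 1
    · simp [tripleTerm, qBinom_zero, nomeTri]
    · intro k hk
      simp [tripleTerm, qBinom_zero, hk]
  | succ n ih =>
    have h1 := (Equiv.subRight (1 : ℤ)).hasSum_iff.mpr ih
    have h2 := (Equiv.addRight (1 : ℤ)).hasSum_iff.mpr ih
    have h := ((ih.mul_left (1 + nome τ ^ (2 * n + 1))).sub (h1.mul_left (w * nome τ ^ n))).sub
      (h2.mul_left (w⁻¹ * nome τ ^ (n + 1)))
    rw [Finset.prod_range_succ]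
    convert! h using 1
    · ext k
      exact tripleTerm_succ hτ hw n k
    · field_simp
      ring

/-- The finite form of the triple product, differentiated at `w = 1`. -/
lemma hasSum_mul_tripleTerm_one {τ : ℂ} (hτ : 0 < τ.im) (n : ℕ) :
    HasSum (fun k : ℤ => (k : ℂ) * tripleTerm τ 1 (n + 1) k) (-(qProd τ n * qProd τ (n + 1))) := by
  -- The product rule at w = 1: T is the value of the finite product there and D its derivative.
  have step : ∀ (n : ℕ) (D T : ℂ), HasSum (tripleTerm τ 1 n) T →
      HasSum (fun k : ℤ => (k : ℂ) * tripleTerm τ 1 n k) D →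
      HasSum (fun k : ℤ => (k : ℂ) * tripleTerm τ 1 (n + 1) k)
        ((1 - nome τ ^ n) * (1 - nome τ ^ (n + 1)) * D + (nome τ ^ (n + 1) - nome τ ^ n) * T) := by
    intro n D T hT hD
    have h1 := (Equiv.subRight (1 : ℤ)).hasSum_iff.mpr hT
    have h2 := (Equiv.addRight (1 : ℤ)).hasSum_iff.mpr hT
    have h3 := (Equiv.subRight (1 : ℤ)).hasSum_iff.mpr hD
    have h4 := (Equiv.addRight (1 : ℤ)).hasSum_iff.mpr hD
    have h := ((hD.mul_left (1 + nome τ ^ (2 * n + 1))).sub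
      ((h3.add h1).mul_left (nome τ ^ n))).sub ((h4.sub h2).mul_left (nome τ ^ (n + 1)))
    convert! h using 1
    · ext k
      rw [tripleTerm_succ hτ one_ne_zero]
      simp only [Function.comp_apply, Equiv.subRight_apply, Equiv.coe_addRight]
      push_cast
      ring
    · ring
  induction n with
  | zero =>
    have h0 : HasSum (fun k : ℤ => (k : ℂ) * tripleTerm τ 1 0 k) 0 := by
      convert! hasSum_zero using 1
      ext k
      by_cases hk : k = 0 <;> simp [tripleTerm, qBinom_zero, hk]
    have h := step 0 _ _ (hasSum_tripleTerm hτ one_ne_zero 0) h0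
    convert! h using 1
    simp [qProd]
  | succ n ih =>
    have h := step (n + 1) _ _ (hasSum_tripleTerm hτ one_ne_zero (n + 1)) ih
    -- Isolates the factor j = 0, which is 1 - w = 0. So T = 0 for every positive index, and T
    -- contributes only to the first derivative.
    rw [Finset.prod_range_succ'] at h
    convert! h using 1
    rw [qProd_succ τ (n + 1), qProd_succ τ n]
    simp
    ring

/-- Gives summability, and so the dominating series, from the two-variable theta function. -/
lemma neg_zpow_mul_nomeTri (τ z : ℂ) (k : ℤ) :
    (-cexp (2 * Real.pi * I * z)) ^ k * nomeTri τ k =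
      jacobiTheta₂_term k (z + 1 / 2 - τ / 2) τ := by
  have : -cexp (2 * Real.pi * I * z) = cexp (2 * Real.pi * I * z + Real.pi * I) := by
    rw [Complex.exp_add, Complex.exp_pi_mul_I]; ring
  rw [this, ← Complex.exp_int_mul, nomeTri, ← Complex.exp_add, jacobiTheta₂_term]
  congr 1
  ring

lemma multipliable_one_sub_mul_nome_pow {τ : ℂ} (hτ : 0 < τ.im) (w : ℂ) :
    Multipliable fun n : ℕ => 1 - w * nome τ ^ n := by
  simp_rw [sub_eq_add_neg]
  apply multipliable_one_add_of_summable
  simpa using (summable_geometric_of_lt_one (norm_nonneg _) (norm_nome_lt_one hτ)).mul_left ‖w‖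

/-- The Jacobi triple product identity. -/
theorem hasSum_triple_product {τ : ℂ} (hτ : 0 < τ.im) (z : ℂ) :
    HasSum (fun k : ℤ => (-cexp (2 * Real.pi * I * z)) ^ k * nomeTri τ k)
      (qProdInf τ * (∏' j : ℕ, (1 - cexp (2 * Real.pi * I * z) * nome τ ^ j)) *
        ∏' j : ℕ, (1 - (cexp (2 * Real.pi * I * z))⁻¹ * nome τ * nome τ ^ j)) := by
  set w := cexp (2 * Real.pi * I * z) with hw_def
  have hw : w ≠ 0 := Complex.exp_ne_zero _
  have hs : Summable fun k : ℤ => (-w) ^ k * nomeTri τ k := by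
    simp_rw [hw_def, neg_zpow_mul_nomeTri]
    exact (summable_jacobiTheta₂_term_iff _ τ).mpr hτ
  obtain ⟨C, hC⟩ := exists_norm_qBinom_le hτ
  have key : Tendsto (fun n => ∑' k : ℤ, tripleTerm τ w n k) atTop
      (𝓝 (∑' k : ℤ, (-w) ^ k * nomeTri τ k * (qProdInf τ)⁻¹)) := by
    refine tendsto_tsum_of_dominated_convergence (hs.norm.mul_right C)
      (fun k => (tendsto_qBinom hτ k).const_mul _) (Eventually.of_forall fun n k => ?_)
    rw [tripleTerm, norm_mul]
    gcongr
    exact hC n k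
  simp_rw [fun n => (hasSum_tripleTerm hτ hw n).tsum_eq, Finset.prod_mul_distrib] at key
  have hp := ((multipliable_one_sub_mul_nome_pow hτ w).hasProd.tendsto_prod_nat).mul
    ((multipliable_one_sub_mul_nome_pow hτ (w⁻¹ * nome τ)).hasProd.tendsto_prod_nat)
  have heq := tendsto_nhds_unique key (by
    refine hp.congr fun n => ?_
    congr 1
    refine Finset.prod_congr rfl fun j _ => ?_
    rw [pow_succ]; ring)
  rw [tsum_mul_right, ← div_eq_mul_inv, div_eq_iff (qProdInf_ne_zero hτ)] at heq
  convert! hs.hasSum using 1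
  rw [heq]
  ring

/-- Jacobi's identity for the cube of `(q; q)_∞`. -/
theorem hasSum_qProdInf_cube {τ : ℂ} (hτ : 0 < τ.im) :
    HasSum (fun k : ℤ => (k : ℂ) * ((-1) ^ k * nomeTri τ k)) (-qProdInf τ ^ 3) := by
  have e : ∀ k : ℤ, (-1) ^ k * nomeTri τ k = jacobiTheta₂_term k (1 / 2 - τ / 2) τ := by
    intro k
    simpa using neg_zpow_mul_nomeTri τ 0 k
  have hs : Summable fun k : ℤ => (k : ℂ) * ((-1) ^ k * nomeTri τ k) := by
    have h := ((summable_jacobiTheta₂'_term_iff (1 / 2 - τ / 2) τ).mpr hτ).mul_left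
      (2 * Real.pi * I)⁻¹
    refine h.congr fun k => ?_
    rw [e, jacobiTheta₂'_term]
    have := Complex.two_pi_I_ne_zero
    field_simp
  obtain ⟨C, hC⟩ := exists_norm_qBinom_le hτ
  have key : Tendsto (fun n => ∑' k : ℤ, (k : ℂ) * tripleTerm τ 1 (n + 1) k) atTop
      (𝓝 (∑' k : ℤ, (k : ℂ) * ((-1) ^ k * nomeTri τ k) * (qProdInf τ)⁻¹)) := by
    refine tendsto_tsum_of_dominated_convergence (hs.norm.mul_right C)
      (fun k => ?_) (Eventually.of_forall fun n k => ?_)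
    · simp_rw [tripleTerm, ← mul_assoc]
      exact ((tendsto_qBinom hτ k).comp (tendsto_add_atTop_nat 1)).const_mul _
    · rw [tripleTerm, ← mul_assoc, norm_mul]
      gcongr
      exact hC _ k
  simp_rw [fun n => (hasSum_mul_tripleTerm_one hτ n).tsum_eq] at key
  have hp := ((tendsto_qProd hτ).mul ((tendsto_qProd hτ).comp (tendsto_add_atTop_nat 1))).neg
  have heq := tendsto_nhds_unique key hp
  rw [tsum_mul_right, ← div_eq_mul_inv, div_eq_iff (qProdInf_ne_zero hτ)] at heq
  convert! hs.hasSum using 1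
  rw [heq]
  ring

/-! ### Splitting series by residue classes -/

lemma tsum_eq_sum_fin {β γ : Type*} {n : ℕ} (e : β × Fin n ≃ γ) {F : γ → ℂ} (hF : Summable F) :
    ∑' c, F c = ∑ r : Fin n, ∑' b, F (e (b, r)) := by
  have h : Summable fun p : Fin n × β => F (e (p.2, p.1)) :=
    hF.comp_injective (e.injective.comp Prod.swap_injective)
  rw [← ((Equiv.prodComm (Fin n) β).trans e).tsum_eq]
  exact h.tsum_prod.trans (tsum_fintype _)

lemma tsum_int_eq_sum_fin (n : ℕ) [NeZero n] {F : ℤ → ℂ} (hF : Summable F) :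
    ∑' k, F k = ∑ r : Fin n, ∑' k : ℤ, F (k * n + r) := by
  simpa using tsum_eq_sum_fin (Int.divModEquiv n).symm hF

lemma tsum_prod_int_eq_sum_fin (n : ℕ) [NeZero n] {F : ℤ × ℤ → ℂ} (hF : Summable F) :
    ∑' p, F p = ∑ r : Fin n, ∑' p : ℤ × ℤ, F (p.1, p.2 * n + r) := by
  simpa using tsum_eq_sum_fin ((Equiv.prodAssoc ℤ ℤ (Fin n)).trans
    ((Equiv.refl ℤ).prodCongr (Int.divModEquiv n).symm)) hF

lemma tsum_prod_int_mod_two {F : ℤ × ℤ → ℂ} (hF : Summable F) :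
    ∑' p, F p = ∑' p : ℤ × ℤ, F (p.1, p.2 * 2) + ∑' p : ℤ × ℤ, F (p.1, p.2 * 2 + 1) := by
  simpa using (tsum_prod_int_eq_sum_fin 2 hF).trans (Fin.sum_univ_two _)

lemma tsum_prod_int_mod_three {F : ℤ × ℤ → ℂ} (hF : Summable F) :
    ∑' p, F p = ∑' p : ℤ × ℤ, F (p.1, p.2 * 3) + ∑' p : ℤ × ℤ, F (p.1, p.2 * 3 + 1) +
      ∑' p : ℤ × ℤ, F (p.1, p.2 * 3 + 2) := by
  simpa using (tsum_prod_int_eq_sum_fin 3 hF).trans (Fin.sum_univ_three _)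

/-! ### Theta series for eta quotients -/

lemma eta_eq (τ : ℂ) : ModularForm.eta τ = cexp (2 * Real.pi * I * τ / 24) * qProdInf τ := by
  simp only [ModularForm.eta, ModularForm.eta_q_eq_pow, Function.Periodic.qParam, qProdInf, nome]
  norm_num

lemma im_natCast_mul_pos {τ : ℂ} (hτ : 0 < τ.im) (n : ℕ) [NeZero n] : 0 < ((n : ℂ) * τ).im := by
  have : 0 < (n : ℝ) := Nat.cast_pos.mpr (NeZero.pos n)
  simpa using mul_pos this hτ

lemma im_ofNat_mul_pos {τ : ℂ} (hτ : 0 < τ.im) (n : ℕ) [n.AtLeastTwo] :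
    0 < ((ofNat(n) : ℂ) * τ).im := by
  have : NeZero n := ⟨by have := Nat.AtLeastTwo.prop (n := n); omega⟩
  exact im_natCast_mul_pos hτ n

lemma nome_natCast_mul (n : ℕ) (τ : ℂ) : nome (n * τ) = nome τ ^ n := by
  rw [nome_pow, nome]
  congr 1
  ring

lemma nome_ofNat_mul (n : ℕ) [n.AtLeastTwo] (τ : ℂ) : nome (ofNat(n) * τ) = nome τ ^ n :=
  nome_natCast_mul n τ

lemma neg_exp_zpow_mul_nomeTri (σ z τ : ℂ) (k : ℤ) (c : ℂ)
    (h : z * k + σ * (k * (k - 1) / 2) = τ * c) :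
    (-cexp (2 * Real.pi * I * z)) ^ k * nomeTri σ k =
      (-1) ^ k * cexp (2 * Real.pi * I * τ * c) := by
  rw [neg_eq_neg_one_mul, mul_zpow, ← Complex.exp_int_mul, nomeTri, mul_assoc, ← Complex.exp_add,
    mul_assoc (2 * Real.pi * I) τ c, ← h]
  congr 2
  ring

/-- Euler's pentagonal number theorem for the eta function. -/
theorem hasSum_eta {τ : ℂ} (hτ : 0 < τ.im) :
    HasSum (fun l : ℤ => (-1) ^ l * cexp (2 * Real.pi * I * τ * ((6 * l + 1) ^ 2 / 24)))
      (ModularForm.eta τ) := by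
  have h3 := im_ofNat_mul_pos hτ 3
  -- Base q³ and w = q; the sign change of the index below turns 6l - 1 into 6l + 1.
  have h := (hasSum_triple_product h3 τ).mul_left (cexp (2 * Real.pi * I * τ / 24))
  rw [← (Equiv.neg ℤ).hasSum_iff] at h
  convert! h using 1
  · ext l
    rw [Function.comp_apply, Equiv.neg_apply,
      neg_exp_zpow_mul_nomeTri (3 * τ) τ τ (-l) ((3 * l ^ 2 + l) / 2) (by push_cast; ring),
      mul_left_comm, ← Complex.exp_add, zpow_neg, ← inv_zpow]
    norm_num
    left
    congr 1
    ring
  · rw [eta_eq]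
    congr 1
    have hq : cexp (2 * Real.pi * I * τ) = nome τ := rfl
    rw [hq, nome_ofNat_mul]
    have t := ((tendsto_qProd h3).mul
      (multipliable_one_sub_mul_nome_pow h3 (nome τ)).hasProd.tendsto_prod_nat).mul
      (multipliable_one_sub_mul_nome_pow h3 ((nome τ)⁻¹ * nome (3 * τ))).hasProd.tendsto_prod_nat
    have t' : Tendsto (fun n : ℕ => qProd τ (n * 3)) atTop (𝓝 (qProdInf τ)) :=
      (tendsto_qProd hτ).comp (tendsto_id.atTop_mul_const' (by norm_num))
    -- The factors 1 - q^i, sorted by i modulo 3.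
    have key : ∀ n : ℕ, qProd τ (n * 3) = qProd (3 * τ) n *
        (∏ j ∈ Finset.range n, (1 - nome τ * nome (3 * τ) ^ j)) *
        ∏ j ∈ Finset.range n, (1 - (nome τ)⁻¹ * nome (3 * τ) * nome (3 * τ) ^ j) := by
      intro n
      induction n with
      | zero => simp [qProd]
      | succ n ih =>
        have hq0 := nome_ne_zero τ
        rw [Finset.prod_range_succ, Finset.prod_range_succ, qProd_succ,
          show (n + 1) * 3 = n * 3 + 1 + 1 + 1 by ring, qProd_succ, qProd_succ, qProd_succ, ih]
        rw [show nome (3 * τ) = nome τ ^ 3 from nome_ofNat_mul 3 τ]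
        have e1 : nome τ * (nome τ ^ 3) ^ n = nome τ ^ (n * 3 + 1) := by ring
        have e2 : (nome τ)⁻¹ * nome τ ^ 3 * (nome τ ^ 3) ^ n = nome τ ^ (n * 3 + 1 + 1) := by
          field_simp; ring
        have e3 : (nome τ ^ 3) ^ (n + 1) = nome τ ^ (n * 3 + 1 + 1 + 1) := by ring
        rw [e1, e2, e3]
        ring
    simp_rw [key] at t'
    rw [nome_ofNat_mul] at t t'
    exact tendsto_nhds_unique t' t

lemma qProdInf_eq_mul_two {τ : ℂ} (hτ : 0 < τ.im) :
    qProdInf τ = (∏' j : ℕ, (1 - nome τ * nome (2 * τ) ^ j)) * qProdInf (2 * τ) := by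
  have h2 := im_ofNat_mul_pos hτ 2
  have e1 : (fun j : ℕ => 1 - nome τ * nome (2 * τ) ^ j) = fun j => 1 - nome τ ^ (2 * j + 1) := by
    ext j
    rw [nome_ofNat_mul]; ring
  have e2 : (fun j : ℕ => 1 - nome (2 * τ) ^ (j + 1)) = fun j => 1 - nome τ ^ (2 * j + 1 + 1) := by
    ext j
    rw [nome_ofNat_mul]; ring
  have m1 := multipliable_one_sub_mul_nome_pow h2 (nome τ)
  have m2 := ModularForm.multipliable_one_sub_pow (norm_nome_lt_one h2)
  rw [e1] at m1
  rw [e2] at m2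
  rw [qProdInf, qProdInf, e1, e2]
  exact (tprod_even_mul_odd (f := fun j => 1 - nome τ ^ (j + 1)) m1 m2).symm

/-- Gauss's product for the theta series with alternating signs. -/
theorem hasSum_eta_sq_div_eta {τ : ℂ} (hτ : 0 < τ.im) :
    HasSum (fun k : ℤ => (-1) ^ k * cexp (2 * Real.pi * I * τ * k ^ 2))
      (ModularForm.eta τ ^ 2 / ModularForm.eta (2 * τ)) := by
  have h2 := im_ofNat_mul_pos hτ 2
  -- Base q² and w = q: the exponent becomes k + k(k-1) = k², and the two infinite products
  -- coincide.
  have h := hasSum_triple_product h2 τ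
  convert! h using 1
  · ext k
    rw [neg_exp_zpow_mul_nomeTri (2 * τ) τ τ k (k ^ 2) (by ring)]
  · have hq : cexp (2 * Real.pi * I * τ) = nome τ := rfl
    have hq0 := nome_ne_zero τ
    have e : (nome τ)⁻¹ * nome (2 * τ) = nome τ := by
      rw [nome_ofNat_mul]; field_simp
    have hP := qProdInf_ne_zero h2
    rw [hq, e, eta_eq, eta_eq, qProdInf_eq_mul_two hτ, div_eq_iff
      (mul_ne_zero (Complex.exp_ne_zero _) hP),
      show 2 * Real.pi * I * (2 * τ) / 24 = 2 * Real.pi * I * τ / 24 + 2 * Real.pi * I * τ / 24 by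
        ring, Complex.exp_add]
    ring

/-- Jacobi's identity for the cube of the eta function. -/
theorem hasSum_eta_cube {τ : ℂ} (hτ : 0 < τ.im) :
    HasSum (fun k : ℤ => (4 * k + 1) * cexp (2 * Real.pi * I * τ * ((4 * k + 1) ^ 2 / 8)))
      (ModularForm.eta τ ^ 3) := by
  have h := (hasSum_qProdInf_cube hτ).mul_left (-cexp (2 * Real.pi * I * τ / 24) ^ 3)
  set F : ℤ → ℂ := fun k => -cexp (2 * Real.pi * I * τ / 24) ^ 3 * (k * ((-1) ^ k * nomeTri τ k))
    with hF
  -- k(k-1)/2 is invariant under k ↦ 1 - k, so the terms at -2k and 2k+1 share the exponent 2k² + k;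
  -- their coefficients add up to 4k + 1.
  have s0 : Summable fun k : ℤ => F (-k * 2) :=
    h.summable.comp_injective fun a b hab => by simpa using hab
  have s1 : Summable fun k : ℤ => F (k * 2 + 1) :=
    h.summable.comp_injective fun a b hab => by simpa using hab
  have t := h.tsum_eq
  rw [tsum_int_eq_sum_fin 2 h.summable, Fin.sum_univ_two] at t
  simp only [Nat.cast_ofNat, Fin.val_zero, Fin.val_one, Nat.cast_zero, Nat.cast_one,
    add_zero] at t
  rw [← (Equiv.neg ℤ).tsum_eq] at t
  simp only [Equiv.neg_apply] at t
  have H := s0.hasSum.add s1.hasSum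
  rw [t] at H
  convert! H using 1
  · ext k
    have p0 : (-1 : ℂ) ^ (-k * 2) = 1 := Even.neg_one_zpow ⟨-k, by ring⟩
    have p1 : (-1 : ℂ) ^ (k * 2 + 1) = -1 := Odd.neg_one_zpow ⟨k, by ring⟩
    have e : ∀ c : ℂ, c = (2 * k ^ 2 + k) → cexp (2 * Real.pi * I * τ / 24) ^ 3 *
        cexp (2 * Real.pi * I * τ * c) = cexp (2 * Real.pi * I * τ * ((4 * k + 1) ^ 2 / 8)) := by
      rintro c rfl
      rw [← Complex.exp_nat_mul, ← Complex.exp_add]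
      congr 1
      push_cast; ring
    have e0 := e ((((-k * 2 : ℤ) : ℂ) * (((-k * 2 : ℤ) : ℂ) - 1)) / 2) (by push_cast; ring)
    have e1 := e ((((k * 2 + 1 : ℤ) : ℂ) * (((k * 2 + 1 : ℤ) : ℂ) - 1)) / 2) (by push_cast; ring)
    simp only [hF, p0, p1, nomeTri]
    linear_combination (norm := (push_cast; ring)) (-2 * (k : ℂ)) * e0 - (2 * k + 1 : ℂ) * e1
  · rw [eta_eq]
    ring

/-! ### Summability and symmetries of double series -/

/-- `q ^ x` for a complex exponent `x`, where `q = e ^ (2 π i τ)`. -/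
def qPow (τ x : ℂ) : ℂ := cexp (2 * Real.pi * I * τ * x)

lemma qPow_add (τ x y : ℂ) : qPow τ (x + y) = qPow τ x * qPow τ y := by
  rw [qPow, mul_add, Complex.exp_add]; rfl

lemma qPow_mul_left (τ c x : ℂ) : qPow (c * τ) x = qPow τ (c * x) := by
  rw [qPow, qPow]; congr 1; ring

lemma nome_zpow_eq_qPow (τ : ℂ) (k : ℤ) : nome τ ^ k = qPow τ k := nome_zpow τ k

lemma mul_qPow_congr {τ a b x y : ℂ} (hab : a = b) (hxy : x = y) :
    a * qPow τ x = b * qPow τ y := by rw [hab, hxy]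

lemma neg_one_zpow_sub (a b : ℤ) : (-1 : ℂ) ^ (a - b) = (-1) ^ a * (-1) ^ b := by
  rw [zpow_sub₀ (by norm_num), div_eq_mul_inv, ← inv_zpow]
  norm_num

lemma neg_one_zpow_neg (a : ℤ) : (-1 : ℂ) ^ (-a) = (-1) ^ a := by
  rw [zpow_neg, ← inv_zpow]
  norm_num

lemma neg_one_zpow_of_even {a : ℤ} (ha : Even a) : (-1 : ℂ) ^ a = 1 := ha.neg_one_zpow

lemma norm_neg_one_zpow (a : ℤ) : ‖(-1 : ℂ) ^ a‖ = 1 := by simp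

lemma summable_pow_mul_qPow {τ : ℂ} (hτ : 0 < τ.im) (j : ℕ) :
    Summable fun k : ℤ => (k : ℂ) ^ j * qPow τ (k ^ 2) := by
  have h2 : 0 < (2 * τ).im := im_ofNat_mul_pos hτ 2
  refine Summable.of_norm_bounded (summable_pow_mul_jacobiTheta₂_term_bound 0 h2 j) fun k => ?_
  rw [norm_mul, norm_pow, Complex.norm_intCast]
  refine mul_le_mul (by simp) ?_ (norm_nonneg _) (by positivity)
  have e : qPow τ (k ^ 2) = jacobiTheta₂_term k 0 (2 * τ) := by
    rw [qPow, jacobiTheta₂_term]; congr 1; ring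
  rw [e]
  exact norm_jacobiTheta₂_term_le h2 (by simp) le_rfl k

lemma summable_pow_mul_pow_mul_qPow {τ : ℂ} (hτ : 0 < τ.im) (N : ℕ) [NeZero N] (i j : ℕ) :
    Summable fun p : ℤ × ℤ =>
      (p.1 : ℂ) ^ i * (p.2 : ℂ) ^ j * qPow τ ((p.1 : ℂ) ^ 2 + N * (p.2 : ℂ) ^ 2) := by
  have h := summable_mul_of_summable_norm (summable_pow_mul_qPow hτ i).norm
    (summable_pow_mul_qPow (im_natCast_mul_pos hτ N) j).norm
  refine h.congr fun p => ?_
  rw [qPow_mul_left, qPow_add]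
  ring

lemma summable_quadratic_mul_qPow {τ : ℂ} (hτ : 0 < τ.im) (N : ℕ) [NeZero N] (a b c : ℂ) :
    Summable fun p : ℤ × ℤ => (a * (p.1 : ℂ) ^ 2 + b * (p.1 * p.2) + c * (p.2 : ℂ) ^ 2) *
      qPow τ ((p.1 : ℂ) ^ 2 + N * (p.2 : ℂ) ^ 2) := by
  have h := (((summable_pow_mul_pow_mul_qPow hτ N 2 0).mul_left a).add
    ((summable_pow_mul_pow_mul_qPow hτ N 1 1).mul_left b)).add
    ((summable_pow_mul_pow_mul_qPow hτ N 0 2).mul_left c)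
  refine h.congr fun p => ?_
  ring

lemma tsum_reindex {α β : Type*} (φ : α → β) (ψ : β → α) (h1 : ∀ p, ψ (φ p) = p)
    (h2 : ∀ p, φ (ψ p) = p) (F : β → ℂ) : ∑' p, F (φ p) = ∑' p, F p :=
  (Equiv.mk φ ψ h1 h2).tsum_eq F

lemma tsum_eq_zero_of_odd {α : Type*} (φ : α → α) (h : ∀ p, φ (φ p) = p) {F : α → ℂ}
    (hF : ∀ p, F (φ p) = -F p) : ∑' p, F p = 0 := by
  have h1 := tsum_reindex φ φ h h F
  simp_rw [hF, tsum_neg] at h1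
  exact self_eq_neg.mp h1.symm

/-- The mixed term of the quadratic coefficient does not contribute. -/
lemma tsum_quadratic_mul_qPow {τ : ℂ} (hτ : 0 < τ.im) (N : ℕ) [NeZero N] (a b c : ℂ) :
    ∑' p : ℤ × ℤ, (a * (p.1 : ℂ) ^ 2 + b * (p.1 * p.2) + c * (p.2 : ℂ) ^ 2) *
      qPow τ ((p.1 : ℂ) ^ 2 + N * (p.2 : ℂ) ^ 2) =
    ∑' p : ℤ × ℤ, (a * (p.1 : ℂ) ^ 2 + c * (p.2 : ℂ) ^ 2) *
      qPow τ ((p.1 : ℂ) ^ 2 + N * (p.2 : ℂ) ^ 2) := by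
  have h0 : ∑' p : ℤ × ℤ, (b * (p.1 * p.2)) * qPow τ ((p.1 : ℂ) ^ 2 + N * (p.2 : ℂ) ^ 2) = 0 := by
    refine tsum_eq_zero_of_odd (fun p => (p.1, -p.2)) (fun p => by simp) fun p => ?_
    push_cast
    ring_nf
  have h1 := summable_quadratic_mul_qPow hτ N a 0 c
  have h2 := summable_quadratic_mul_qPow hτ N 0 b 0
  simp only [zero_mul, add_zero, zero_add] at h1 h2
  rw [← add_zero (∑' p : ℤ × ℤ, (a * (p.1 : ℂ) ^ 2 + c * (p.2 : ℂ) ^ 2) * _), ← h0,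
    ← h1.tsum_add h2]
  refine tsum_congr fun p => ?_
  ring

/-- Splitting a double series by the parity of `m + n`. -/
lemma tsum_eq_add_of_parity {F : ℤ × ℤ → ℂ} (hF : Summable F) :
    ∑' p, F p = ∑' p : ℤ × ℤ, F (p.1 + p.2, p.1 - p.2) +
      ∑' p : ℤ × ℤ, F (p.1 + p.2 + 1, p.1 - p.2) := by
  have h1 := tsum_reindex (fun p : ℤ × ℤ => (p.1 + p.2, p.1)) (fun p => (p.2, p.1 - p.2))
    (fun p => by ext <;> simp) (fun p => by ext <;> simp) F
  have hs : Summable fun p : ℤ × ℤ => F (p.1 + p.2, p.1) := by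
    refine hF.comp_injective (i := fun p : ℤ × ℤ => (p.1 + p.2, p.1)) fun p p' h => ?_
    simp only [Prod.mk.injEq] at h
    ext <;> omega
  rw [← h1, tsum_prod_int_mod_two hs]
  congr 1
  · rw [← tsum_reindex (fun p : ℤ × ℤ => (p.1 - p.2, p.2)) (fun p => (p.1 + p.2, p.2))
      (fun p => by ext <;> simp) (fun p => by ext <;> simp)]
    refine tsum_congr fun p => congrArg F ?_
    ext <;> simp
    ring
  · rw [← tsum_reindex (fun p : ℤ × ℤ => (p.1 - p.2, p.2)) (fun p => (p.1 + p.2, p.2))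
      (fun p => by ext <;> simp) (fun p => by ext <;> simp)]
    refine tsum_congr fun p => congrArg F ?_
    ext <;> simp
    ring

lemma hasSum_mul {F G : ℤ → ℂ} {a b : ℂ} (hF : HasSum F a) (hG : HasSum G b) :
    HasSum (fun p : ℤ × ℤ => F p.1 * G p.2) (a * b) :=
  hF.mul hG (summable_mul_of_summable_norm hF.summable.norm hG.summable.norm)

/-! ### The linear theta series modulo 3 -/

lemma summable_linear_mul_qPow_third {τ : ℂ} (hτ : 0 < τ.im) :
    Summable fun k : ℤ => (3 * k + 1 : ℂ) * qPow τ ((3 * k + 1) ^ 2 / 3) := by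
  have h3 : 0 < ((1 / 3 : ℝ) * τ).im := by simpa using hτ
  have h := (summable_pow_mul_qPow h3 1).comp_injective (i := fun k : ℤ => 3 * k + 1)
    fun a b hab => by simpa using hab
  refine h.congr fun k => ?_
  rw [Function.comp_apply, qPow_mul_left]
  refine mul_qPow_congr (by push_cast; ring) (by push_cast; ring)

/-- After multiplication by η(4τ), both sides are double series. With a = 4m+1 and n = a+k, they are
matched through a²/2 + k² = n²/3 + (3a-2n)²/6. -/
theorem hasSum_linear_mul_qPow_third {τ : ℂ} (hτ : 0 < τ.im) :
    HasSum (fun k : ℤ => (3 * k + 1 : ℂ) * qPow τ ((3 * k + 1) ^ 2 / 3))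
      (ModularForm.eta τ ^ 2 * ModularForm.eta (4 * τ) ^ 2 / ModularForm.eta (2 * τ)) := by
  have h4 := im_ofNat_mul_pos hτ 4
  have hA := (summable_linear_mul_qPow_third hτ).hasSum
  have hV := hasSum_mul hA (hasSum_eta h4)
  have hX := hasSum_mul (hasSum_eta_cube h4) (hasSum_eta_sq_div_eta hτ)
  -- the odd correction to the linear factor
  have hY : Summable fun p : ℤ × ℤ => ((p.2 : ℂ) * (-1) ^ p.2) *
      qPow τ ((4 * p.1 + 1 : ℂ) ^ 2 / 2 + (p.2 : ℂ) ^ 2) := by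
    have h2 : 0 < ((1 / 2 : ℝ) * τ).im := by simpa using hτ
    have hs := (summable_pow_mul_qPow h2 0).comp_injective (i := fun k : ℤ => 4 * k + 1)
      fun a b hab => by simpa using hab
    have h := summable_mul_of_summable_norm hs.norm (summable_pow_mul_qPow hτ 1).norm
    refine Summable.of_norm_bounded h.norm fun p => le_of_eq ?_
    rw [qPow_add]
    simp only [Function.comp_apply, norm_mul, norm_neg_one_zpow, qPow_mul_left, pow_zero, pow_one,
      one_mul, mul_one]
    rw [show ((1 / 2 : ℝ) : ℂ) * ((4 * p.1 + 1 : ℤ) : ℂ) ^ 2 = (4 * p.1 + 1 : ℂ) ^ 2 / 2 by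
      push_cast; ring]
    ring
  have hY0 : ∑' p : ℤ × ℤ, ((p.2 : ℂ) * (-1) ^ p.2) *
      qPow τ ((4 * p.1 + 1 : ℂ) ^ 2 / 2 + (p.2 : ℂ) ^ 2) = 0 := by
    refine tsum_eq_zero_of_odd (fun p => (p.1, -p.2)) (fun p => by simp) fun p => ?_
    rw [← neg_mul]
    refine mul_qPow_congr ?_ ?_
    · rw [neg_one_zpow_neg]; push_cast; ring
    · push_cast; ring
  have hZ := hX.add (hY0 ▸ hY.hasSum)
  rw [add_zero] at hZ
  -- The odd correction has made the linear factor 4m+1+k, which is now the second coordinate.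
  set Z : ℤ × ℤ → ℂ := fun p => ((p.2 : ℂ) * (-1) ^ (p.2 - 4 * p.1 - 1)) *
      qPow τ ((4 * p.1 + 1 : ℂ) ^ 2 / 2 + (p.2 - 4 * p.1 - 1 : ℂ) ^ 2) with hZdef
  have hZ' : HasSum Z (ModularForm.eta (4 * τ) ^ 3 *
      (ModularForm.eta τ ^ 2 / ModularForm.eta (2 * τ))) := by
    rw [← (Equiv.mk (fun p : ℤ × ℤ => (p.1, p.2 - 4 * p.1 - 1)) (fun p => (p.1, p.2 + 4 * p.1 + 1))
      (fun p => by ext <;> grind) (fun p => by ext <;> grind)).hasSum_iff] at hZ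
    convert! hZ using 1
    ext p
    simp only [Function.comp_apply, Equiv.coe_fn_mk, hZdef]
    change _ = (_ * qPow (4 * τ) _) * (_ * qPow τ _) + _
    rw [qPow_mul_left, qPow_add, qPow_add,
      show (4 : ℂ) * ((4 * p.1 + 1) ^ 2 / 8) = (4 * p.1 + 1) ^ 2 / 2 by ring]
    push_cast
    ring
  have tZ := hZ'.tsum_eq
  rw [tsum_prod_int_mod_three hZ'.summable] at tZ
  -- For n divisible by 3, the map n ↦ -n with 3a-2n fixed preserves the lattice and negates the
  -- term.
  have r0 : ∑' p : ℤ × ℤ, Z (p.1, p.2 * 3) = 0 := by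
    refine tsum_eq_zero_of_odd (fun p => (p.1 - p.2, -p.2)) (fun p => by ext <;> simp) fun p => ?_
    simp only [hZdef]
    rw [← neg_mul]
    refine mul_qPow_congr ?_ ?_
    · rw [show -p.2 * 3 - 4 * (p.1 - p.2) - 1 =
        (p.2 * 3 - 4 * p.1 - 1) - 2 * p.2 by ring,
        neg_one_zpow_sub _ (2 * p.2), neg_one_zpow_of_even (even_two_mul _)]
      push_cast
      ring
    · push_cast
      ring
  -- The second coordinate is the sum of the two indices: its even values match n = 3k+1, its odd
  -- values n = -(3k+1).
  set V : ℤ × ℤ → ℂ := fun p => ((3 * p.1 + 1 : ℂ) * (-1) ^ (p.2 - p.1)) *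
      qPow τ ((3 * p.1 + 1 : ℂ) ^ 2 / 3 + (6 * (p.2 - p.1) + 1 : ℂ) ^ 2 / 6) with hVdef
  have hV' : HasSum V ((∑' k : ℤ, (3 * k + 1 : ℂ) * qPow τ ((3 * k + 1) ^ 2 / 3)) *
      ModularForm.eta (4 * τ)) := by
    rw [← (Equiv.mk (fun p : ℤ × ℤ => (p.1, p.2 - p.1)) (fun p => (p.1, p.2 + p.1))
      (fun p => by ext <;> simp) (fun p => by ext <;> simp)).hasSum_iff] at hV
    convert! hV using 1
    ext p
    simp only [Function.comp_apply, Equiv.coe_fn_mk, hVdef]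
    change _ = _ * (_ * qPow (4 * τ) _)
    rw [qPow_mul_left, qPow_add]
    push_cast
    rw [show (4 : ℂ) * ((6 * (p.2 - p.1) + 1) ^ 2 / 24) = (6 * (p.2 - p.1) + 1) ^ 2 / 6 by ring]
    ring
  have tV := hV'.tsum_eq
  rw [tsum_prod_int_mod_two hV'.summable] at tV
  have r1 : ∑' p : ℤ × ℤ, Z (p.1, p.2 * 3 + 1) =
      ∑' p : ℤ × ℤ, V (p.1, p.2 * 2) := by
    rw [← tsum_reindex Prod.swap Prod.swap Prod.swap_swap Prod.swap_swap]
    refine tsum_congr fun p => ?_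
    simp only [hZdef, hVdef, Prod.fst_swap, Prod.snd_swap]
    refine mul_qPow_congr ?_ ?_
    · rw [show p.1 * 3 + 1 - 4 * p.2 - 1 =
        (p.2 * 2 - p.1) - 2 * (3 * p.2 - 2 * p.1) by ring,
        neg_one_zpow_sub _ (2 * _), neg_one_zpow_of_even (even_two_mul _)]
      push_cast
      ring
    · push_cast
      ring
  have r2 : ∑' p : ℤ × ℤ, Z (p.1, p.2 * 3 + 2) =
      ∑' p : ℤ × ℤ, V (p.1, p.2 * 2 + 1) := by
    rw [← tsum_reindex (fun p : ℤ × ℤ => (-1 - p.2, -1 - p.1)) (fun p => (-1 - p.2, -1 - p.1))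
      (fun p => by ext <;> simp) (fun p => by ext <;> simp)]
    refine tsum_congr fun p => ?_
    simp only [hZdef, hVdef]
    refine mul_qPow_congr ?_ ?_
    · rw [show (-1 - p.1) * 3 + 2 - 4 * (-1 - p.2) - 1 =
        (p.2 * 2 + 1 - p.1) - 2 * (p.1 - p.2 - 1) - 1 by ring,
        neg_one_zpow_sub _ 1, neg_one_zpow_sub _ (2 * _), neg_one_zpow_of_even (even_two_mul _)]
      push_cast
      ring
    · push_cast
      ring
  have hne := ModularForm.eta_ne_zero (z := 4 * τ) h4
  rw [r0, r1, r2, zero_add, tV] at tZ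
  convert! hA using 1
  rw [← mul_left_inj' hne, tZ]
  ring

/-! ### The three double series -/

lemma hasSum_eta_cube_mul {τ : ℂ} (hτ : 0 < τ.im) (M : ℕ) [M.AtLeastTwo] :
    HasSum (fun k : ℤ => (4 * k + 1 : ℂ) * qPow τ (ofNat(M) * ((4 * k + 1) ^ 2 / 8)))
      (ModularForm.eta (ofNat(M) * τ) ^ 3) := by
  refine (hasSum_eta_cube (im_ofNat_mul_pos hτ M)).congr_fun fun k => ?_
  rw [← qPow_mul_left]; rfl

/-- Leaves b free, to be chosen so that the coefficient factors. -/
lemma hasSum_of_quadratic {τ : ℂ} (hτ : 0 < τ.im) (N : ℕ) [N.AtLeastTwo] {b s : ℂ}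
    (h : ∑' p : ℤ × ℤ, (1 / 2 * (p.1 : ℂ) ^ 2 + b * (p.1 * p.2) +
      -(ofNat(N) / 2) * (p.2 : ℂ) ^ 2) * qPow τ ((p.1 : ℂ) ^ 2 + ofNat(N) * (p.2 : ℂ) ^ 2) = s) :
    HasSum (fun p : ℤ × ℤ => (((p.1 : ℂ) ^ 2 - ofNat(N) * (p.2 : ℂ) ^ 2) / 2) *
      nome τ ^ (p.1 ^ 2 + ofNat(N) * p.2 ^ 2 : ℤ)) s := by
  have : NeZero N := ⟨by have := Nat.AtLeastTwo.prop (n := N); omega⟩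
  have hN : (N : ℂ) = ofNat(N) := Nat.cast_ofNat
  have hs := (summable_quadratic_mul_qPow hτ N (1 / 2) 0 (-(ofNat(N) / 2))).hasSum
  have ht := tsum_quadratic_mul_qPow hτ N (1 / 2) b (-(ofNat(N) / 2))
  simp only [zero_mul, add_zero, hN] at hs ht
  rw [← ht, h] at hs
  refine hs.congr_fun fun p => ?_
  rw [nome_zpow_eq_qPow]
  refine mul_qPow_congr ?_ ?_
  · ring
  · push_cast; rfl

lemma summable_quadratic {τ : ℂ} (hτ : 0 < τ.im) (N : ℕ) [N.AtLeastTwo] (b : ℂ) :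
    Summable fun p : ℤ × ℤ => (1 / 2 * (p.1 : ℂ) ^ 2 + b * (p.1 * p.2) +
      -(ofNat(N) / 2) * (p.2 : ℂ) ^ 2) * qPow τ ((p.1 : ℂ) ^ 2 + ofNat(N) * (p.2 : ℂ) ^ 2) := by
  have : NeZero N := ⟨by have := Nat.AtLeastTwo.prop (n := N); omega⟩
  have hN : (N : ℂ) = ofNat(N) := Nat.cast_ofNat
  simpa only [hN] using summable_quadratic_mul_qPow hτ N (1 / 2) b (-(ofNat(N) / 2))

theorem hasSum_f {τ : ℂ} (hτ : 0 < τ.im) :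
    HasSum (fun p : ℤ × ℤ => (((p.1 : ℂ) ^ 2 - 2 * (p.2 : ℂ) ^ 2) / 2) *
      nome τ ^ (p.1 ^ 2 + 2 * p.2 ^ 2 : ℤ)) (f τ) := by
  have h2 := im_ofNat_mul_pos hτ 2
  have h4 := im_ofNat_mul_pos hτ 4
  have hA := hasSum_mul (hasSum_linear_mul_qPow_third hτ) (hasSum_linear_mul_qPow_third h2)
  refine hasSum_of_quadratic hτ 2 (b := 1 / 2) ?_
  have hs := summable_quadratic hτ 2 (1 / 2)
  set F : ℤ × ℤ → ℂ := fun p => _ with hF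
  change Summable F at hs
  change ∑' p, F p = _
  -- The coordinates n and m-n, ready for splitting by m-n modulo 3.
  have e1 := tsum_reindex (fun p : ℤ × ℤ => (p.1 + p.2, p.1)) (fun p => (p.2, p.1 - p.2))
    (fun p => by ext <;> simp) (fun p => by ext <;> simp) F
  have hs1 : Summable fun p : ℤ × ℤ => F (p.1 + p.2, p.1) := by
    refine hs.comp_injective (i := fun p : ℤ × ℤ => (p.1 + p.2, p.1)) fun p p' h => ?_
    simp only [Prod.mk.injEq] at h
    ext <;> omega
  rw [← e1, tsum_prod_int_mod_three hs1]
  -- The involution negates m+2n and fixes m-n.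
  have r0 : ∑' p : ℤ × ℤ, F (p.1 + p.2 * 3, p.1) = 0 := by
    refine tsum_eq_zero_of_odd (fun p => (-p.1 - 2 * p.2, p.2))
      (fun p => by ext <;> grind) fun p => ?_
    simp only [hF]
    rw [← neg_mul]
    exact mul_qPow_congr (by push_cast; ring) (by push_cast; ring)
  have r1 : ∑' p : ℤ × ℤ, F (p.1 + (p.2 * 3 + 1), p.1) = 1 / 2 * f τ := by
    rw [← tsum_reindex (fun p : ℤ × ℤ => (p.1 - p.2, p.2)) (fun p => (p.1 + p.2, p.2))
      (fun p => by ext <;> simp) (fun p => by ext <;> simp)]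
    have hf : f τ = ModularForm.eta τ ^ 2 * ModularForm.eta (4 * τ) ^ 2 /
        ModularForm.eta (2 * τ) * (ModularForm.eta (2 * τ) ^ 2 *
        ModularForm.eta (4 * (2 * τ)) ^ 2 / ModularForm.eta (2 * (2 * τ))) := by
      have n2 := ModularForm.eta_ne_zero (z := 2 * τ) h2
      have n4 := ModularForm.eta_ne_zero (z := 4 * τ) h4
      rw [f, ← mul_assoc 4 2 τ, ← mul_assoc 2 2 τ]
      norm_num
      field_simp
    rw [hf, ← hA.tsum_eq, ← tsum_mul_left]
    refine tsum_congr fun p => ?_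
    rw [qPow_mul_left, mul_mul_mul_comm, ← qPow_add, ← mul_assoc]
    exact mul_qPow_congr (by push_cast; ring) (by push_cast; ring)
  have r2 : ∑' p : ℤ × ℤ, F (p.1 + (p.2 * 3 + 2), p.1) = 1 / 2 * f τ := by
    rw [← r1, ← tsum_reindex (fun p : ℤ × ℤ => (-p.1, -1 - p.2)) (fun p => (-p.1, -1 - p.2))
      (fun p => by ext <;> simp) (fun p => by ext <;> simp)]
    refine tsum_congr fun p => ?_
    exact mul_qPow_congr (by push_cast; ring) (by push_cast; ring)
  rw [r0, r1, r2]
  ring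

theorem hasSum_g {τ : ℂ} (hτ : 0 < τ.im) :
    HasSum (fun p : ℤ × ℤ => (((p.1 : ℂ) ^ 2 - 3 * (p.2 : ℂ) ^ 2) / 2) *
      nome τ ^ (p.1 ^ 2 + 3 * p.2 ^ 2 : ℤ)) (g τ) := by
  have hA := hasSum_mul (hasSum_eta_cube_mul hτ 2) (hasSum_eta_cube_mul hτ 6)
  refine hasSum_of_quadratic hτ 3 (b := 1) ?_
  have hs := summable_quadratic hτ 3 1
  set F : ℤ × ℤ → ℂ := fun p => _ with hF
  change Summable F at hs
  change ∑' p, F p = _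
  have hs0 : Summable fun p : ℤ × ℤ => F (p.1 + p.2, p.1 - p.2) := by
    refine hs.comp_injective (i := fun p : ℤ × ℤ => (p.1 + p.2, p.1 - p.2)) fun p p' h => ?_
    simp only [Prod.mk.injEq] at h
    ext <;> omega
  have hs1 : Summable fun p : ℤ × ℤ => F (p.1 + p.2 + 1, p.1 - p.2) := by
    refine hs.comp_injective (i := fun p : ℤ × ℤ => (p.1 + p.2 + 1, p.1 - p.2)) fun p p' h => ?_
    simp only [Prod.mk.injEq] at h
    ext <;> omega
  -- the units of order three permute the even part
  have r0 : ∑' p : ℤ × ℤ, F (p.1 + p.2, p.1 - p.2) = 0 := by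
    set E : ℤ × ℤ → ℂ := fun p => F (p.1 + p.2, p.1 - p.2) with hE
    -- Multiplication by a cube root of unity on the form x² - xy + y²; the three coefficients along
    -- an orbit add up to zero.
    let ω : ℤ × ℤ ≃ ℤ × ℤ := Equiv.mk (fun p => (-p.2, p.1 - p.2)) (fun p => (p.2 - p.1, -p.1))
      (fun p => by ext <;> simp) (fun p => by ext <;> simp)
    have t1 := ω.tsum_eq E
    have t2 := ω.symm.tsum_eq E
    have s1 : Summable fun p => E (ω p) := hs0.comp_injective ω.injective
    have s2 : Summable fun p => E (ω.symm p) := hs0.comp_injective ω.symm.injective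
    have z : ∀ p, E p + E (ω p) + E (ω.symm p) = 0 := by
      intro p
      have q0 : E p = (4 * p.1 * p.2 - 2 * p.2 ^ 2 : ℂ) *
          qPow τ (4 * (p.1 ^ 2 - p.1 * p.2 + p.2 ^ 2)) :=
        mul_qPow_congr (by push_cast; ring) (by push_cast; ring)
      have q1 : E (ω p) = (2 * p.2 ^ 2 - 2 * p.1 ^ 2 : ℂ) *
          qPow τ (4 * (p.1 ^ 2 - p.1 * p.2 + p.2 ^ 2)) :=
        mul_qPow_congr (by simp only [ω, Equiv.coe_fn_mk]; push_cast; ring)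
          (by simp only [ω, Equiv.coe_fn_mk]; push_cast; ring)
      have q2 : E (ω.symm p) = (2 * p.1 ^ 2 - 4 * p.1 * p.2 : ℂ) *
          qPow τ (4 * (p.1 ^ 2 - p.1 * p.2 + p.2 ^ 2)) :=
        mul_qPow_congr (by simp only [ω, Equiv.coe_fn_symm_mk]; push_cast; ring)
          (by simp only [ω, Equiv.coe_fn_symm_mk]; push_cast; ring)
      rw [q0, q1, q2]
      ring
    have hsum := (hs0.add s1).tsum_add s2
    rw [hs0.tsum_add s1] at hsum
    change ∑' p, (E p + E (ω p) + E (ω.symm p)) =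
      ∑' p, E p + ∑' p, E (ω p) + ∑' p, E (ω.symm p) at hsum
    simp_rw [z] at hsum
    rw [t1, t2, tsum_zero] at hsum
    linear_combination (-1 / 3 : ℂ) * hsum
  have r1 : ∑' p : ℤ × ℤ, F (p.1 + p.2 * 2 + 1, p.1 - p.2 * 2) = 1 / 2 * g τ := by
    rw [← tsum_reindex (fun p : ℤ × ℤ => (p.1 + p.2, p.2)) (fun p => (p.1 - p.2, p.2))
      (fun p => by ext <;> simp) (fun p => by ext <;> simp), g, ← hA.tsum_eq, ← tsum_mul_left]
    refine tsum_congr fun p => ?_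
    rw [mul_mul_mul_comm, ← qPow_add, ← mul_assoc]
    exact mul_qPow_congr (by push_cast; ring) (by push_cast; ring)
  have r2 : ∑' p : ℤ × ℤ, F (p.1 + (p.2 * 2 + 1) + 1, p.1 - (p.2 * 2 + 1)) = 1 / 2 * g τ := by
    rw [← r1, ← tsum_reindex (fun p : ℤ × ℤ => (-1 - p.1, -1 - p.2)) (fun p => (-1 - p.1, -1 - p.2))
      (fun p => by ext <;> simp) (fun p => by ext <;> simp)]
    refine tsum_congr fun p => ?_
    exact mul_qPow_congr (by push_cast; ring) (by push_cast; ring)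
  rw [tsum_eq_add_of_parity hs, r0, tsum_prod_int_mod_two hs1, r1, r2]
  ring

theorem hasSum_h {τ : ℂ} (hτ : 0 < τ.im) :
    HasSum (fun p : ℤ × ℤ => (((p.1 : ℂ) ^ 2 - 4 * (p.2 : ℂ) ^ 2) / 2) *
      nome τ ^ (p.1 ^ 2 + 4 * p.2 ^ 2 : ℤ)) (h τ) := by
  have hA := hasSum_mul (hasSum_eta_cube_mul hτ 4) (hasSum_eta_cube_mul hτ 4)
  refine hasSum_of_quadratic hτ 4 (b := 0) ?_
  have hs := summable_quadratic hτ 4 0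
  set F : ℤ × ℤ → ℂ := fun p => _ with hF
  change Summable F at hs
  change ∑' p, F p = _
  have hs' : Summable fun p : ℤ × ℤ => F (p.2, p.1) :=
    hs.comp_injective Prod.swap_injective
  -- For m even, exchanging m/2 and n negates m² - 4n² and fixes m² + 4n².
  have r0 : ∑' p : ℤ × ℤ, F (p.2 * 2, p.1) = 0 := by
    refine tsum_eq_zero_of_odd Prod.swap Prod.swap_swap fun p => ?_
    simp only [hF]
    rw [← neg_mul]
    refine mul_qPow_congr ?_ ?_ <;> (rw [Prod.fst_swap, Prod.snd_swap]; push_cast; ring)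
  have r1 : ∑' p : ℤ × ℤ, F ((p.1 + p.2) * 2 + 1, p.1 - p.2) = 1 / 2 * h τ := by
    rw [show h τ = ModularForm.eta (4 * τ) ^ 3 * ModularForm.eta (4 * τ) ^ 3 by rw [h]; ring,
      ← hA.tsum_eq, ← tsum_mul_left]
    refine tsum_congr fun p => ?_
    rw [mul_mul_mul_comm, ← qPow_add, ← mul_assoc]
    exact mul_qPow_congr (by push_cast; ring) (by push_cast; ring)
  -- The reindexing is m ↦ -m with n fixed.
  have r2 : ∑' p : ℤ × ℤ, F ((p.1 + p.2 + 1) * 2 + 1, p.1 - p.2) = 1 / 2 * h τ := by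
    rw [← r1, ← tsum_reindex (fun p : ℤ × ℤ => (-1 - p.2, -1 - p.1)) (fun p => (-1 - p.2, -1 - p.1))
      (fun p => by ext <;> simp) (fun p => by ext <;> simp)]
    refine tsum_congr fun p => ?_
    exact mul_qPow_congr (by push_cast; ring) (by push_cast; ring)
  have hs2 : Summable fun p : ℤ × ℤ => F (p.1 * 2 + 1, p.2) :=
    hs.comp_injective (i := fun p : ℤ × ℤ => (p.1 * 2 + 1, p.2)) fun p p' h => by
      simp only [Prod.mk.injEq] at h
      ext <;> omega
  have e1 : ∑' p : ℤ × ℤ, F (p.2, p.1) = ∑' p, F p := (Equiv.prodComm ℤ ℤ).tsum_eq F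
  have e2 : ∑' p : ℤ × ℤ, F (p.2 * 2 + 1, p.1) = ∑' p : ℤ × ℤ, F (p.1 * 2 + 1, p.2) :=
    (Equiv.prodComm ℤ ℤ).tsum_eq fun p : ℤ × ℤ => F (p.1 * 2 + 1, p.2)
  rw [← e1, tsum_prod_int_mod_two hs', r0, e2, tsum_eq_add_of_parity hs2, r1, r2]
  ring

end EtaTheta

end

theorem lemma5 (τ : ℂ) (hτ : 0 < τ.im) :
    HasSum (fun p : ℤ × ℤ =>
        (((p.1 : ℂ) ^ 2 - 2 * (p.2 : ℂ) ^ 2) / 2) *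
          EtaTheta.nome τ ^ (p.1 ^ 2 + 2 * p.2 ^ 2 : ℤ)) (EtaTheta.f τ) ∧
    HasSum (fun p : ℤ × ℤ =>
        (((p.1 : ℂ) ^ 2 - 3 * (p.2 : ℂ) ^ 2) / 2) *
          EtaTheta.nome τ ^ (p.1 ^ 2 + 3 * p.2 ^ 2 : ℤ)) (EtaTheta.g τ) ∧
    HasSum (fun p : ℤ × ℤ =>
        (((p.1 : ℂ) ^ 2 - 4 * (p.2 : ℂ) ^ 2) / 2) *
          EtaTheta.nome τ ^ (p.1 ^ 2 + 4 * p.2 ^ 2 : ℤ)) (EtaTheta.h τ) :=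
  ⟨EtaTheta.hasSum_f hτ, EtaTheta.hasSum_g hτ, EtaTheta.hasSum_h hτ⟩
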